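/- Let $\mathcal H$ be a complex Hilbert space, let $n\ge 2$, and put $I_n=\{1,\dots,n\}$. A bounded operator $T$ on $\mathcal H$ is a near-isometry if there is $\delta>0$ with $\delta\|x\|\le\|Tx\|\le\|x\|$ for all $x\in\mathcal H$, and $T^{*m}T^{m+1}\mathcal H\subseteq T\mathcal H$ for all $m\ge 0$. A tuple $(T_1,\dots,T_n)$ of near-isometries on $\mathcal H$ is a doubly twisted near-isometry with respect to commuting unitaries $\{U_{ij}\}_{1\le i<j\le n}$ on $\mathcal H$ if $T_i^*T_j=U_{ij}^*T_jT_i^*$, $T_kU_{ij}=U_{ij}T_k$ and $T_iT_j=U_{ij}T_jT_i$ for all $1\le i<j\le n$ and $1\le k\le n$. An operator $T$ on a Hilbert space $\mathcal K$ is a shift if there is a closed subspace $\mathcal W\subseteq\mathcal K$ with $T^i\mathcal W\perp T^j\mathcal W$ for $i\ne j$ and $\mathcal K=\bigoplus_{m\ge 0}T^m\mathcal W$. A Wold-type decomposition of $(T_1,\dots,T_n)$ is a family $\{\mathcal H_A\}_{A\subseteq I_n}$ of closed subspaces, each reducing every $T_i$, such that $\mathcal H=\bigoplus_{A\subseteq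 I_n}\mathcal H_A$ (orthogonal sum), $T_i|_{\mathcal H_A}$ is a shift if $i\in A$, and $T_i|_{\mathcal H_A}$ is invertible if $i\in I_n\setminus A$. (Zero summands are allowed.) For $A=\{a_1<\dots<a_m\}\subseteq I_n$ and $\boldsymbol k\in\mathbb N_0^{m}$ write $T_A^{\boldsymbol k}=T_{a_1}^{k_1}\cdots T_{a_m}^{k_m}$, and let $\mathcal W_A=\bigcap_{i\in A}\ker T_i^*$, with $\mathcal W_\emptyset=\mathcal H$. Theorem. Every doubly twisted near-isometry $(T_1,\dots,T_n)$ on $\mathcal H$ admits exactly one Wold-type decomposition $\mathcal H=\bigoplus_{A\subseteq I_n}\mathcal H_A$. Its summands are, for every $A\subseteq I_n$, the orthogonal sums of closed subspaces $$\mathcal H_A=\bigoplus_{\boldsymbol k\in\mathbb N_0^{|A|}}T_A^{\boldsymbol k}\Big(\bigcap_{\boldsymbol\ell\in\mathbb N_0^{n-|A|}}T_{I_n\setminus A}^{\boldsymbol\ell}\,\mathcal W_A\Big),$$ and in particular $\mathcal H_\emptyset=\bigcap_{\boldsymbol k\in\mathbb N_0^{n}}T_{I_n}^{\boldsymbol k}\mathcal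 H$. -/

import Mathlib

open ContinuousLinearMap

/-- A bounded operator `T` is a near-isometry if it is a contraction which is bounded below and
`T*ⁿ Tⁿ⁺¹ H ⊆ T H` for every `n ≥ 0`. -/
structure IsNearIsometry {H : Type*} [NormedAddCommGroup H] [InnerProductSpace ℂ H]
    [CompleteSpace H] (T : H →L[ℂ] H) : Prop where
  bounds : ∃ δ : ℝ, 0 < δ ∧ ∀ x : H, δ * ‖x‖ ≤ ‖T x‖ ∧ ‖T x‖ ≤ ‖x‖
  range_subset : ∀ (n : ℕ) (x : H), ∃ y : H, (adjoint T ^ n) ((T ^ (n + 1)) x) = T y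

/-- `T = (T₁, …, Tₙ)` is a doubly twisted near-isometry with respect to the commuting unitaries
`U i j`, `i < j` (the values of `U` at the other pairs of indices play no role). -/
structure IsDoublyTwistedNearIsometry {H : Type*} [NormedAddCommGroup H] [InnerProductSpace ℂ H]
    [CompleteSpace H] {n : ℕ} (T : Fin n → H →L[ℂ] H) (U : Fin n → Fin n → H →L[ℂ] H) :
    Prop where
  nearIsometry : ∀ i, IsNearIsometry (T i)
  unitary : ∀ i j, i < j → U i j ∈ unitary (H →L[ℂ] H)
  commute : ∀ i j k l, i < j → k < l → Commute (U i j) (U k l)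
  adjoint_mul : ∀ i j, i < j → adjoint (T i) * T j = adjoint (U i j) * T j * adjoint (T i)
  mul_twist : ∀ i j k, i < j → T k * U i j = U i j * T k
  mul_mul : ∀ i j, i < j → T i * T j = U i j * T j * T i

/-- `M` is the internal orthogonal (Hilbert space) direct sum of the closed subspaces `V i`. -/
structure IsOrthogonalSum {H : Type*} [NormedAddCommGroup H] [InnerProductSpace ℂ H] {ι : Type*}
    (M : Submodule ℂ H) (V : ι → Submodule ℂ H) : Prop where
  isClosed : ∀ i, IsClosed (V i : Set H)
  orthogonal : ∀ i j, i ≠ j → V i ⟂ V j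
  closure_iSup : (⨆ i, V i).topologicalClosure = M

/-- The image `T W` of a subspace under a bounded operator. -/
def imageUnder {H : Type*} [NormedAddCommGroup H] [InnerProductSpace ℂ H]
    (T : H →L[ℂ] H) (W : Submodule ℂ H) : Submodule ℂ H :=
  W.map (T : H →ₗ[ℂ] H)

/-- A closed subspace `W` is wandering for `T` if `Tⁱ W ⟂ Tʲ W` for `i ≠ j`. -/
def IsWandering {H : Type*} [NormedAddCommGroup H] [InnerProductSpace ℂ H]
    (T : H →L[ℂ] H) (W : Submodule ℂ H) : Prop :=
  IsClosed (W : Set H) ∧ ∀ i j : ℕ, i ≠ j → imageUnder (T ^ i) W ⟂ imageUnder (T ^ j) W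

/-- `T` is a shift if the whole space is `⨁ₖ Tᵏ W` for some wandering subspace `W`. -/
def IsShift {H : Type*} [NormedAddCommGroup H] [InnerProductSpace ℂ H] (T : H →L[ℂ] H) : Prop :=
  ∃ W : Submodule ℂ H, IsWandering T W ∧
    IsOrthogonalSum ⊤ (fun k : ℕ => imageUnder (T ^ k) W)

/-- `M` reduces `T`: it is invariant under both `T` and `T*`. -/
structure Reduces {H : Type*} [NormedAddCommGroup H] [InnerProductSpace ℂ H] [CompleteSpace H]
    (M : Submodule ℂ H) (T : H →L[ℂ] H) : Prop where
  map_mem : ∀ x ∈ M, T x ∈ M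
  adjoint_map_mem : ∀ x ∈ M, adjoint T x ∈ M

/-- The restriction `T|_M : M → M` of `T` to a reducing subspace `M`. -/
noncomputable def Reduces.restriction {H : Type*} [NormedAddCommGroup H] [InnerProductSpace ℂ H]
    [CompleteSpace H] {M : Submodule ℂ H} {T : H →L[ℂ] H} (h : Reduces M T) : M →L[ℂ] M :=
  T.restrict h.map_mem

/-- The family `(𝓗 A)`, `A ⊆ {1, …, n}`, of closed subspaces is a Wold-type decomposition of the
space for the tuple `T`. (Closedness of each `𝓗 A` is part of `IsOrthogonalSum`.) -/
structure IsWoldDecomposition {H : Type*} [NormedAddCommGroup H] [InnerProductSpace ℂ H]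
    [CompleteSpace H] {n : ℕ} (T : Fin n → H →L[ℂ] H) (𝓗 : Finset (Fin n) → Submodule ℂ H) :
    Prop where
  orthogonalSum : IsOrthogonalSum ⊤ 𝓗
  reduces : ∀ A i, Reduces (𝓗 A) (T i)
  shift : ∀ A i, i ∈ A → IsShift (reduces A i).restriction
  invertible : ∀ A i, i ∉ A → IsUnit (reduces A i).restriction

/-- `T_A^k = T_{a₁}^{k₁} ⋯ T_{aₘ}^{kₘ}` for `A = {a₁ < ⋯ < aₘ}`: the product over all indices in
increasing order, with the identity in the places outside `A`. -/
noncomputable def tuplePow {H : Type*} [NormedAddCommGroup H] [InnerProductSpace ℂ H] {n : ℕ}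
    (T : Fin n → H →L[ℂ] H) (A : Finset (Fin n)) (k : A → ℕ) : H →L[ℂ] H :=
  (List.ofFn fun i : Fin n => if h : i ∈ A then T i ^ k ⟨i, h⟩ else 1).prod

/-- `W_A = ⋂_{i ∈ A} ker T_i*`, the whole space when `A` is empty. -/
noncomputable def wanderingSpace {H : Type*} [NormedAddCommGroup H] [InnerProductSpace ℂ H]
    [CompleteSpace H] {n : ℕ} (T : Fin n → H →L[ℂ] H) (A : Finset (Fin n)) : Submodule ℂ H :=
  ⨅ i ∈ A, LinearMap.ker (adjoint (T i) : H →ₗ[ℂ] H)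

/-- `⋂_ℓ T_{Aᶜ}^ℓ W_A`, where `ℓ` runs over the multi-indices indexed by the complement of `A`. -/
noncomputable def wanderingCore {H : Type*} [NormedAddCommGroup H] [InnerProductSpace ℂ H]
    [CompleteSpace H] {n : ℕ} (T : Fin n → H →L[ℂ] H) (A : Finset (Fin n)) : Submodule ℂ H :=
  ⨅ l : ↥(Aᶜ : Finset (Fin n)) → ℕ, imageUnder (tuplePow T Aᶜ l) (wanderingSpace T A)

/-! ### Ranges of powers, their layers and their intersection. -/

section PowerRanges

variable {H : Type*} [NormedAddCommGroup H] [InnerProductSpace ℂ H]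

/-! For a single near-isometry, the range condition makes `T ^ k` carry `ker T*` onto the layer
`powLayer T k` (`IsNearIsometry.powLayer_eq`). Hence `powCore T` reduces `T`, and its complement is
the closed span of the images of `ker T*`: the classical Wold splitting into an invertible and a
shift part.

For a tuple, the twist relations make every `T j` with `j ≠ i` reduce the ranges of the powers of `T
i` (`powRange_reduces`), so all the cores reduce all the operators. Choosing for each index the core
or its complement gives `2 ^ n` orthogonal spaces `woldSpace T A`, which span `H`
(`iSup_woldSpace`).

Uniqueness holds because a reducing subspace with invertible restriction lies in the core and one
with shift restriction is orthogonal to it; so any decomposition sits summand by summand inside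
`woldSpace T`, and must fill it. For the formula, `wanderingCore T A` is `woldSpace T A ⊓
wanderingSpace T A`, and `le_of_listPow_mem` regenerates `woldSpace T A` from it one index at a
time. -/

theorem Submodule.isClosed_iInf_coe {ι : Sort*} {M : ι → Submodule ℂ H}
    (h : ∀ i, IsClosed (M i : Set H)) : IsClosed ((⨅ i, M i : Submodule ℂ H) : Set H) := by
  rw [Submodule.coe_iInf]
  exact isClosed_iInter h

theorem Submodule.isClosed_inf_coe {M N : Submodule ℂ H}
    (hM : IsClosed (M : Set H)) (hN : IsClosed (N : Set H)) :
    IsClosed ((M ⊓ N : Submodule ℂ H) : Set H) := by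
  rw [Submodule.coe_inf]
  exact hM.inter hN

theorem Submodule.isClosed_comap_coe {N : Submodule ℂ H} (hN : IsClosed (N : Set H))
    (T : H →L[ℂ] H) : IsClosed ((N.comap (T : H →ₗ[ℂ] H) : Submodule ℂ H) : Set H) :=
  hN.preimage T.continuous

/-- The range of the power `T ^ k`. -/
noncomputable def powRange (T : H →L[ℂ] H) (k : ℕ) : Submodule ℂ H := imageUnder (T ^ k) ⊤

/-- The orthogonal difference of the ranges of `T ^ k` and `T ^ (k + 1)`. -/
noncomputable def powLayer (T : H →L[ℂ] H) (k : ℕ) : Submodule ℂ H := powRange T k ⊓ (powRange T (k + 1))ᗮ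

/-- The invertible part `⋂ₖ Tᵏ H`. -/
noncomputable def powCore (T : H →L[ℂ] H) : Submodule ℂ H := ⨅ k, powRange T k

theorem mem_imageUnder {T : H →L[ℂ] H} {W : Submodule ℂ H} {x : H} :
    x ∈ imageUnder T W ↔ ∃ y ∈ W, T y = x := Iff.rfl

theorem mem_powRange {T : H →L[ℂ] H} {k : ℕ} {x : H} :
    x ∈ powRange T k ↔ ∃ y, (T ^ k) y = x := by
  simp [powRange, mem_imageUnder]

theorem mem_powCore {T : H →L[ℂ] H} {x : H} : x ∈ powCore T ↔ ∀ k, x ∈ powRange T k :=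
  Submodule.mem_iInf _

theorem powRange_succ_le (T : H →L[ℂ] H) (k : ℕ) : powRange T (k + 1) ≤ powRange T k := by
  intro x hx
  obtain ⟨y, rfl⟩ := mem_powRange.1 hx
  exact mem_powRange.2 ⟨T y, by rw [pow_succ]; rfl⟩

theorem powRange_antitone (T : H →L[ℂ] H) : Antitone (powRange T) :=
  antitone_nat_of_succ_le (powRange_succ_le T)

theorem powRange_zero (T : H →L[ℂ] H) : powRange T 0 = ⊤ :=
  eq_top_iff.2 fun x _ => mem_powRange.2 ⟨x, by simp⟩

theorem powLayer_isOrtho (T : H →L[ℂ] H) {i j : ℕ} (h : i ≠ j) : powLayer T i ⟂ powLayer T j := by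
  have key : ∀ {i j : ℕ}, i < j → powLayer T j ⟂ powLayer T i := fun {i j} hij =>
    (Submodule.isOrtho_orthogonal_right _).mono (inf_le_left.trans (powRange_antitone T hij))
      inf_le_right
  rcases h.lt_or_gt with h | h
  · exact (key h).symm
  · exact key h

theorem powLayer_le_orthogonal_powCore (T : H →L[ℂ] H) (k : ℕ) :
    powLayer T k ≤ (powCore T)ᗮ :=
  inf_le_right.trans (Submodule.orthogonal_le (iInf_le _ _))

end PowerRanges

/-! ### Reducing subspaces and spanning by layers. -/

section Reducing

variable {H : Type*} [NormedAddCommGroup H] [InnerProductSpace ℂ H] [CompleteSpace H]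

theorem Reduces.orthogonal {M : Submodule ℂ H} {T : H →L[ℂ] H} (h : Reduces M T) :
    Reduces Mᗮ T where
  map_mem x hx := by
    rw [Submodule.mem_orthogonal]
    intro u hu
    rw [← adjoint_inner_left]
    exact (Submodule.mem_orthogonal _ _).1 hx _ (h.adjoint_map_mem u hu)
  adjoint_map_mem x hx := by
    rw [Submodule.mem_orthogonal]
    intro u hu
    rw [adjoint_inner_right]
    exact (Submodule.mem_orthogonal _ _).1 hx _ (h.map_mem u hu)

theorem Reduces.inf {M N : Submodule ℂ H} {T : H →L[ℂ] H} (hM : Reduces M T)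
    (hN : Reduces N T) : Reduces (M ⊓ N) T where
  map_mem x hx := ⟨hM.map_mem x hx.1, hN.map_mem x hx.2⟩
  adjoint_map_mem x hx := ⟨hM.adjoint_map_mem x hx.1, hN.adjoint_map_mem x hx.2⟩

theorem Reduces.iInf {ι : Sort*} {M : ι → Submodule ℂ H} {T : H →L[ℂ] H}
    (h : ∀ i, Reduces (M i) T) : Reduces (⨅ i, M i) T where
  map_mem x hx := by
    rw [Submodule.mem_iInf] at hx ⊢
    exact fun i => (h i).map_mem x (hx i)
  adjoint_map_mem x hx := by
    rw [Submodule.mem_iInf] at hx ⊢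
    exact fun i => (h i).adjoint_map_mem x (hx i)

theorem Reduces.pow {M : Submodule ℂ H} {T : H →L[ℂ] H} (h : Reduces M T) (k : ℕ) :
    Reduces M (T ^ k) := by
  induction k with
  | zero => exact ⟨fun x hx => by simpa using hx, fun x hx => by
      rw [pow_zero, ← star_eq_adjoint, star_one]; simpa using hx⟩
  | succ k ih =>
    refine ⟨fun x hx => ?_, fun x hx => ?_⟩
    · rw [pow_succ]
      exact ih.map_mem _ (h.map_mem x hx)
    · rw [pow_succ', ← star_eq_adjoint, star_mul]
      exact ih.adjoint_map_mem _ (h.adjoint_map_mem x hx)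

theorem Reduces.starProjection_apply {M : Submodule ℂ H} [M.HasOrthogonalProjection]
    {T : H →L[ℂ] H} (h : Reduces M T) (x : H) :
    M.starProjection (T x) = T (M.starProjection x) := by
  refine Submodule.eq_starProjection_of_mem_orthogonal
    (h.map_mem _ (Submodule.starProjection_apply_mem M x)) ?_
  rw [← map_sub]
  exact h.orthogonal.map_mem _ (Submodule.sub_starProjection_mem_orthogonal x)

/-- The projection `P` onto `M` commutes with `T`, so `T (P y) = P (T y) = T y`, and injectivity
gives `P y = y`. -/
theorem Reduces.mem_of_map_mem {M : Submodule ℂ H} {T : H →L[ℂ] H} (h : Reduces M T)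
    (hM : IsClosed (M : Set H)) (hT : Function.Injective T) {y : H} (hy : T y ∈ M) : y ∈ M := by
  have : CompleteSpace M := hM.completeSpace_coe
  have h1 := h.starProjection_apply y
  rw [Submodule.starProjection_eq_self_iff.2 hy] at h1
  rw [hT h1]
  exact Submodule.starProjection_apply_mem M y

theorem Reduces.restriction_pow_coe {M : Submodule ℂ H} {T : H →L[ℂ] H} (h : Reduces M T)
    (k : ℕ) (x : M) : (((h.restriction ^ k) x : M) : H) = (T ^ k) x := by
  induction k generalizing x with
  | zero => simp
  | succ k ih =>
    rw [pow_succ, pow_succ, mul_apply_eq_comp, ih]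
    rfl

/-- A closed subspace is contained in another one if the orthogonal complements are related. -/
theorem Submodule.le_of_orthogonal_le {M N : Submodule ℂ H} (hN : IsClosed (N : Set H))
    (h : Nᗮ ≤ Mᗮ) : M ≤ N := by
  have : CompleteSpace N := hN.completeSpace_coe
  calc M ≤ Mᗮᗮ := Submodule.le_orthogonal_orthogonal M
    _ ≤ Nᗮᗮ := Submodule.orthogonal_le h
    _ = N := Submodule.orthogonal_orthogonal N

theorem powLayer_zero (T : H →L[ℂ] H) :
    powLayer T 0 = LinearMap.ker (adjoint T : H →ₗ[ℂ] H) := by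
  ext x
  rw [powLayer, powRange_zero, top_inf_eq, Submodule.mem_orthogonal, LinearMap.mem_ker]
  constructor
  · intro h
    refine ext_inner_left ℂ fun v => ?_
    have := h (T v) (mem_powRange.2 ⟨v, by simp⟩)
    simpa [adjoint_inner_right] using this
  · intro h u hu
    obtain ⟨y, rfl⟩ := mem_powRange.1 hu
    have h' : adjoint T x = 0 := h
    rw [zero_add, pow_one, ← adjoint_inner_right, h', inner_zero_right]

/-- The subspace `(⋂ₖ Tᵏ H)ᗮ` is the closed span of the layers. -/
theorem orthogonal_powCore_le {T : H →L[ℂ] H} (hT : ∀ k, IsClosed (powRange T k : Set H))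
    {Z : Submodule ℂ H} (hZ : IsClosed (Z : Set H)) (h : ∀ k, powLayer T k ≤ Z) :
    (powCore T)ᗮ ≤ Z := by
  refine Submodule.le_of_orthogonal_le hZ ?_
  refine le_trans ?_ (Submodule.le_orthogonal_orthogonal _)
  intro x hx
  rw [mem_powCore]
  intro k
  -- A vector `x ⟂ Z` climbs through the ranges: if `x` is in the `k`-th one, its component off the
  -- next lies in layer `k`, hence in `Z`, so it is orthogonal to `x` as well as to `u`, and
  -- vanishes.
  induction k with
  | zero => rw [powRange_zero]; trivial
  | succ k ih =>
    have : CompleteSpace (powRange T (k + 1)) := (hT (k + 1)).completeSpace_coe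
    set u := (powRange T (k + 1)).starProjection x with hu
    have hu1 : u ∈ powRange T (k + 1) := Submodule.starProjection_apply_mem _ x
    have hv : x - u ∈ (powRange T (k + 1))ᗮ := Submodule.sub_starProjection_mem_orthogonal x
    have hvL : x - u ∈ powLayer T k :=
      ⟨Submodule.sub_mem _ ih (powRange_succ_le T k hu1), hv⟩
    have h1 : inner ℂ (x - u) x = 0 := (Submodule.mem_orthogonal _ _).1 hx _ (h k hvL)
    have h2 : inner ℂ (x - u) u = 0 := Submodule.inner_left_of_mem_orthogonal hu1 hv
    have h3 : x - u = 0 := by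
      rw [← inner_self_eq_zero (𝕜 := ℂ), inner_sub_right, h1, h2, sub_zero]
    rw [sub_eq_zero.1 h3]
    exact hu1

/-- The ranges of the powers of `T` reduce the projection onto a reducing subspace of `T`. -/
theorem powRange_reduces_starProjection {T : H →L[ℂ] H} {N : Submodule ℂ H}
    [N.HasOrthogonalProjection] (h : Reduces N T) (k : ℕ) :
    Reduces (powRange T k) N.starProjection := by
  have key : ∀ x ∈ powRange T k, N.starProjection x ∈ powRange T k := by
    intro x hx
    obtain ⟨y, rfl⟩ := mem_powRange.1 hx
    rw [(h.pow k).starProjection_apply]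
    exact mem_powRange.2 ⟨_, rfl⟩
  refine ⟨key, ?_⟩
  rw [← star_eq_adjoint, (isSelfAdjoint_starProjection N).star_eq]
  exact key

theorem powCore_reduces_starProjection {T : H →L[ℂ] H} {N : Submodule ℂ H}
    [N.HasOrthogonalProjection] (h : Reduces N T) :
    Reduces (powCore T) N.starProjection :=
  Reduces.iInf fun k => powRange_reduces_starProjection h k

/-- A closed reducing subspace of the shift part is the closed span of its layers. -/
theorem Reduces.le_of_inf_powLayer_le {T : H →L[ℂ] H}
    (hT : ∀ k, IsClosed (powRange T k : Set H)) {N : Submodule ℂ H} (h : Reduces N T)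
    (hN : IsClosed (N : Set H)) (hNE : N ≤ (powCore T)ᗮ)
    {Z : Submodule ℂ H} (hZ : IsClosed (Z : Set H)) (hL : ∀ k, N ⊓ powLayer T k ≤ Z) : N ≤ Z := by
  have : CompleteSpace N := hN.completeSpace_coe
  -- The projection onto `N` maps each layer into `N ⊓ powLayer T k`, so it maps the whole shift
  -- part into `Z`; on `N` it is the identity.
  have h1 : (powCore T)ᗮ ≤ Z.comap (N.starProjection : H →ₗ[ℂ] H) := by
    refine orthogonal_powCore_le hT (Submodule.isClosed_comap_coe hZ _) fun k x hx => ?_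
    refine hL k ⟨Submodule.starProjection_apply_mem N x, ?_⟩
    exact ((powRange_reduces_starProjection h k).inf
      (powRange_reduces_starProjection h (k + 1)).orthogonal).map_mem x hx
  intro x hx
  have h2 : N.starProjection x ∈ Z := h1 (hNE hx)
  rwa [Submodule.starProjection_eq_self_iff.2 hx] at h2

end Reducing

theorem imageUnder_pow_succ {H : Type*} [NormedAddCommGroup H] [InnerProductSpace ℂ H]
    (S : H →L[ℂ] H) (k : ℕ) (W : Submodule ℂ H) :
    imageUnder (S ^ (k + 1)) W = imageUnder S (imageUnder (S ^ k) W) := by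
  rw [imageUnder, imageUnder, imageUnder, ← Submodule.map_comp, pow_succ']
  rfl

/-! ### Wold decomposition of a single near-isometry. -/

section NearIsometry

variable {H : Type*} [NormedAddCommGroup H] [InnerProductSpace ℂ H] [CompleteSpace H]
  {T : H →L[ℂ] H}

theorem IsNearIsometry.antilipschitz (hT : IsNearIsometry T) :
    ∃ K : NNReal, AntilipschitzWith K T := by
  obtain ⟨δ, hδ, h⟩ := hT.bounds
  refine ⟨⟨δ⁻¹, (inv_pos.2 hδ).le⟩, T.antilipschitz_of_bound fun x => ?_⟩
  change ‖x‖ ≤ δ⁻¹ * ‖T x‖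
  rw [inv_mul_eq_div, le_div_iff₀ hδ, mul_comm]
  exact (h x).1

theorem IsNearIsometry.injective (hT : IsNearIsometry T) : Function.Injective T :=
  hT.antilipschitz.choose_spec.injective

theorem IsNearIsometry.pow_injective (hT : IsNearIsometry T) (k : ℕ) :
    Function.Injective (T ^ k : H →L[ℂ] H) := by
  induction k with
  | zero => exact fun x y h => h
  | succ k ih => rw [pow_succ]; exact ih.comp hT.injective

theorem IsNearIsometry.isClosed_imageUnder (hT : IsNearIsometry T) {W : Submodule ℂ H}
    (hW : IsClosed (W : Set H)) : IsClosed (imageUnder T W : Set H) := by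
  obtain ⟨K, hK⟩ := hT.antilipschitz
  exact (hK.isClosedEmbedding T.uniformContinuous).isClosedMap _ hW

theorem IsNearIsometry.isClosed_imageUnder_pow (hT : IsNearIsometry T) {W : Submodule ℂ H}
    (hW : IsClosed (W : Set H)) (k : ℕ) : IsClosed (imageUnder (T ^ k) W : Set H) := by
  induction k with
  | zero =>
    have : imageUnder (T ^ 0) W = W := by
      rw [pow_zero]; exact Submodule.map_id W
    rwa [this]
  | succ k ih =>
    rw [imageUnder_pow_succ]
    exact hT.isClosed_imageUnder ih

theorem IsNearIsometry.isClosed_powRange (hT : IsNearIsometry T) (k : ℕ) :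
    IsClosed (powRange T k : Set H) :=
  hT.isClosed_imageUnder_pow isClosed_univ k

theorem IsNearIsometry.isClosed_powCore (hT : IsNearIsometry T) :
    IsClosed (powCore T : Set H) :=
  Submodule.isClosed_iInf_coe hT.isClosed_powRange

/-- This is where the range condition enters: `⟪T^(k+1) y, T^k w⟫ = ⟪T*^k T^(k+1) y, w⟫ = ⟪T z, w⟫ =
0`. -/
theorem IsNearIsometry.pow_mem_powLayer (hT : IsNearIsometry T) {w : H}
    (hw : w ∈ powLayer T 0) (k : ℕ) : (T ^ k) w ∈ powLayer T k := by
  refine ⟨mem_powRange.2 ⟨w, rfl⟩, ?_⟩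
  refine (Submodule.mem_orthogonal _ _).2 fun u hu => ?_
  obtain ⟨y, rfl⟩ := mem_powRange.1 hu
  obtain ⟨z, hz⟩ := hT.range_subset k y
  have hw' : adjoint T w = 0 := by
    rw [powLayer_zero] at hw
    exact hw
  rw [← adjoint_inner_left, ← star_eq_adjoint, star_pow, star_eq_adjoint, hz,
    ← adjoint_inner_right, hw', inner_zero_right]

/-- For `T^k y` in the layer, split `y = T z + w` with `w ∈ ker T*`. Since `T^k w` is in the layer
too, `T^(k+1) z` is orthogonal to the range containing it, so it is zero and `T^k y = T^k w`. -/
theorem IsNearIsometry.powLayer_eq (hT : IsNearIsometry T) (k : ℕ) :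
    powLayer T k = imageUnder (T ^ k) (powLayer T 0) := by
  refine le_antisymm ?_ ?_
  · rintro x ⟨hx1, hx2⟩
    obtain ⟨y, rfl⟩ := mem_powRange.1 hx1
    have : CompleteSpace (powRange T 1) := (hT.isClosed_powRange 1).completeSpace_coe
    obtain ⟨z, hz⟩ := mem_powRange.1
      (Submodule.starProjection_apply_mem (powRange T 1) y)
    have hw := Submodule.sub_starProjection_mem_orthogonal (K := powRange T 1) y
    rw [← hz, pow_one] at hw
    have hw0 : y - T z ∈ powLayer T 0 := ⟨by rw [powRange_zero]; trivial, hw⟩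
    have h1 := (hT.pow_mem_powLayer hw0 k).2
    have h2 : (T ^ (k + 1)) z ∈ (powRange T (k + 1))ᗮ := by
      have : (T ^ (k + 1)) z = (T ^ k) y - (T ^ k) (y - T z) := by
        rw [map_sub, sub_sub_cancel, pow_succ]
        rfl
      rw [this]
      exact Submodule.sub_mem _ hx2 h1
    have h3 : (T ^ (k + 1)) z = 0 := by
      rw [← inner_self_eq_zero (𝕜 := ℂ)]
      exact Submodule.inner_right_of_mem_orthogonal (mem_powRange.2 ⟨z, rfl⟩) h2
    refine ⟨y - T z, hw0, ?_⟩
    change (T ^ k) (y - T z) = (T ^ k) y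
    rw [map_sub, sub_eq_self, ← h3, pow_succ]
    rfl
  · rintro _ ⟨w, hw, rfl⟩
    exact hT.pow_mem_powLayer hw k

/-- `T` sends layer `k` into layer `k + 1`, so the complement of the core is `T`-invariant, which by
duality is the invariance of the core under `T*`. -/
theorem IsNearIsometry.powCore_reduces (hT : IsNearIsometry T) : Reduces (powCore T) T := by
  have hperp : (powCore T)ᗮ ≤ (powCore T)ᗮ.comap (T : H →ₗ[ℂ] H) := by
    refine orthogonal_powCore_le hT.isClosed_powRange
      (Submodule.isClosed_comap_coe (Submodule.isClosed_orthogonal _) T) fun k x hx => ?_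
    refine powLayer_le_orthogonal_powCore T (k + 1) ?_
    rw [hT.powLayer_eq] at hx ⊢
    rw [imageUnder_pow_succ]
    exact ⟨x, hx, rfl⟩
  have : CompleteSpace (powCore T) := hT.isClosed_powCore.completeSpace_coe
  refine ⟨fun x hx => ?_, fun x hx => ?_⟩
  · rw [mem_powCore] at hx ⊢
    intro k
    refine powRange_succ_le T k ?_
    obtain ⟨y, rfl⟩ := mem_powRange.1 (hx k)
    exact mem_powRange.2 ⟨y, by rw [pow_succ']; rfl⟩
  · rw [← Submodule.orthogonal_orthogonal (powCore T), Submodule.mem_orthogonal]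
    intro u hu
    rw [adjoint_inner_right]
    exact Submodule.inner_left_of_mem_orthogonal hx (hperp hu)

/-- A closed reducing subspace inside `⋂ₖ Tᵏ H` is mapped onto itself. -/
theorem Reduces.imageUnder_eq {N : Submodule ℂ H} (h : Reduces N T) (hT : IsNearIsometry T)
    (hN : IsClosed (N : Set H)) (hNE : N ≤ powCore T) : imageUnder T N = N := by
  refine le_antisymm ?_ fun x hx => ?_
  · rintro _ ⟨x, hx, rfl⟩
    exact h.map_mem x hx
  · obtain ⟨y, rfl⟩ := mem_powRange.1 (mem_powCore.1 (hNE hx) 1)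
    rw [pow_one] at hx ⊢
    exact ⟨y, h.mem_of_map_mem hN hT.injective hx, rfl⟩

theorem Reduces.isUnit_restriction {N : Submodule ℂ H} (h : Reduces N T) (hT : IsNearIsometry T)
    (hN : IsClosed (N : Set H)) (hNE : N ≤ powCore T) : IsUnit h.restriction := by
  have : CompleteSpace N := hN.completeSpace_coe
  rw [isUnit_iff_bijective]
  refine ⟨fun x y hxy => Subtype.ext (hT.injective (congrArg Subtype.val hxy)), fun x => ?_⟩
  have hx : (x : H) ∈ imageUnder T N := by
    rw [h.imageUnder_eq hT hN hNE]
    exact x.2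
  obtain ⟨y, hy, hyx⟩ := hx
  exact ⟨⟨y, hy⟩, Subtype.ext hyx⟩

/-- The wandering subspace is `N ∩ ker T*`; its image under the `k`-th power is exactly the trace of
layer `k` on `N`. -/
theorem Reduces.isShift_restriction {N : Submodule ℂ H} (h : Reduces N T) (hT : IsNearIsometry T)
    (hN : IsClosed (N : Set H)) (hNE : N ≤ (powCore T)ᗮ) : IsShift h.restriction := by
  set W : Submodule ℂ N := (powLayer T 0).comap N.subtype with hW
  have hcl : ∀ k, IsClosed (powLayer T k : Set H) := fun k =>
    Submodule.isClosed_inf_coe (hT.isClosed_powRange k) (Submodule.isClosed_orthogonal _)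
  have him : ∀ k, imageUnder (h.restriction ^ k) W = (powLayer T k).comap N.subtype := by
    intro k
    ext x
    rw [Submodule.mem_comap, hT.powLayer_eq, mem_imageUnder, mem_imageUnder]
    constructor
    · rintro ⟨y, hy, rfl⟩
      exact ⟨y, hy, (h.restriction_pow_coe k y).symm⟩
    · rintro ⟨y, hy, hyx⟩
      have hyN : y ∈ N := (h.pow k).mem_of_map_mem hN (hT.pow_injective k) (hyx ▸ x.2)
      exact ⟨⟨y, hyN⟩, hy, Subtype.ext ((h.restriction_pow_coe k _).trans hyx)⟩
  have hclosed : ∀ k, IsClosed (((powLayer T k).comap N.subtype : Submodule ℂ N) : Set N) :=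
    fun k => (hcl k).preimage continuous_subtype_val
  have hort : ∀ i j, i ≠ j →
      imageUnder (h.restriction ^ i) W ⟂ imageUnder (h.restriction ^ j) W := by
    intro i j hij
    rw [him, him]
    exact Submodule.IsOrtho.comap N.subtypeₗᵢ (powLayer_isOrtho T hij)
  refine ⟨W, ⟨hclosed 0, hort⟩, ⟨fun k => by rw [him]; exact hclosed k, hort, ?_⟩⟩
  rw [eq_top_iff]
  -- The spanning argument is run in `H`; as `N` is closed, the image of `Y` there is still closed.
  set Y : Submodule ℂ N := (⨆ k, imageUnder (h.restriction ^ k) W).topologicalClosure with hY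
  have hZ : IsClosed ((Y.map N.subtype : Submodule ℂ H) : Set H) :=
    hN.isClosedEmbedding_subtypeVal.isClosedMap _ (Submodule.isClosed_topologicalClosure _)
  have hle : N ≤ Y.map N.subtype := by
    refine h.le_of_inf_powLayer_le hT.isClosed_powRange hN hNE hZ fun k x hx => ?_
    refine ⟨⟨x, hx.1⟩, Submodule.le_topologicalClosure _ (Submodule.mem_iSup_of_mem k ?_), rfl⟩
    rw [him]
    exact hx.2
  intro x _
  obtain ⟨y, hy, hyx⟩ := hle x.2
  rwa [← Subtype.ext hyx]

theorem Reduces.le_powCore_of_isUnit {N : Submodule ℂ H} (h : Reduces N T)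
    (hu : IsUnit h.restriction) : N ≤ powCore T := by
  intro x hx
  rw [mem_powCore]
  intro k
  obtain ⟨S, hS⟩ := (hu.pow k).exists_right_inv
  refine mem_powRange.2 ⟨(S ⟨x, hx⟩ : N), ?_⟩
  rw [← h.restriction_pow_coe, ← mul_apply_eq_comp, hS]
  rfl

/-- The ranges of the powers of a shift intersect trivially. -/
theorem IsShift.eq_zero_of_forall_mem_range {K : Type*} [NormedAddCommGroup K]
    [InnerProductSpace ℂ K] {S : K →L[ℂ] K} (hS : IsShift S) {x : K}
    (hx : ∀ k : ℕ, ∃ y, (S ^ k) y = x) : x = 0 := by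
  obtain ⟨W, hW, hsum⟩ := hS
  have h1 : (⨆ k, imageUnder (S ^ k) W) ≤ (ℂ ∙ x)ᗮ := by
    refine iSup_le fun j => ?_
    rintro _ ⟨w, hw, rfl⟩
    rw [Submodule.mem_orthogonal_singleton_iff_inner_left]
    obtain ⟨y, hy⟩ := hx (j + 1)
    -- The whole range of `S ^ (j + 1)` is orthogonal to `S ^ j W`: it suffices to test it on the
    -- vectors `S ^ k v`, which land in `S ^ (j + 1 + k) W`.
    have h2 : (⨆ k, imageUnder (S ^ k) W).topologicalClosure ≤
        (ℂ ∙ (S ^ j) w)ᗮ.comap ((S ^ (j + 1) : K →L[ℂ] K) : K →ₗ[ℂ] K) := by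
      refine Submodule.topologicalClosure_minimal _ (iSup_le fun k => ?_)
        ((Submodule.isClosed_orthogonal _).preimage (S ^ (j + 1)).continuous)
      rintro _ ⟨v, hv, rfl⟩
      rw [Submodule.mem_comap, Submodule.mem_orthogonal_singleton_iff_inner_right]
      refine (hW.2 j (j + 1 + k) (by omega)).inner_eq ⟨w, hw, rfl⟩ ⟨v, hv, ?_⟩
      rw [pow_add S (j + 1) k]
      rfl
    rw [hsum.closure_iSup] at h2
    rw [← hy]
    exact Submodule.mem_orthogonal_singleton_iff_inner_right.1 (h2 (Submodule.mem_top (x := y)))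
  have h3 := Submodule.topologicalClosure_minimal _ h1 (Submodule.isClosed_orthogonal _)
  rw [hsum.closure_iSup] at h3
  exact inner_self_eq_zero.1
    (Submodule.mem_orthogonal_singleton_iff_inner_left.1 (h3 (Submodule.mem_top (x := x))))

/-- Projecting a core vector to `N` commutes with the powers of `T`, so the projection lies in every
power range of the shift and is zero. -/
theorem Reduces.le_orthogonal_powCore_of_isShift {N : Submodule ℂ H} (h : Reduces N T)
    (hN : IsClosed (N : Set H)) (hs : IsShift h.restriction) : N ≤ (powCore T)ᗮ := by
  have : CompleteSpace N := hN.completeSpace_coe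
  refine (Submodule.isOrtho_iff_le.1 (Submodule.IsOrtho.symm ?_))
  rw [Submodule.isOrtho_iff_le]
  intro x hx
  rw [← Submodule.starProjection_apply_eq_zero_iff]
  have hz : (⟨N.starProjection x, Submodule.starProjection_apply_mem N x⟩ : N) = 0 := by
    refine hs.eq_zero_of_forall_mem_range fun k => ?_
    obtain ⟨y, rfl⟩ := mem_powRange.1 (mem_powCore.1 hx k)
    refine ⟨⟨N.starProjection y, Submodule.starProjection_apply_mem N y⟩, Subtype.ext ?_⟩
    rw [h.restriction_pow_coe]
    exact ((h.pow k).starProjection_apply y).symm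
  exact congrArg Subtype.val hz

end NearIsometry

/-! ### Twisted commutation and invariance of ranges. -/

section Twisted

variable {H : Type*} [NormedAddCommGroup H] [InnerProductSpace ℂ H]

/-- Moving `S` past one factor `T` costs a `V`, which commutes with `T` and is absorbed into the
vector: `S T^(k+1) y = T S T^k (V y)`. Hence the induction over all `y`. -/
theorem map_mem_powRange_of_twist {S T V : H →L[ℂ] H} (h : S * T = T * (S * V))
    (hV : Commute T V) (k : ℕ) {x : H} (hx : x ∈ powRange T k) : S x ∈ powRange T k := by
  obtain ⟨y, rfl⟩ := mem_powRange.1 hx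
  clear hx
  induction k generalizing y with
  | zero => rw [powRange_zero]; trivial
  | succ k ih =>
    obtain ⟨z, hz⟩ := mem_powRange.1 (ih (V y))
    refine mem_powRange.2 ⟨z, ?_⟩
    have h1 : S * T ^ (k + 1) = T * (S * (T ^ k * V)) := by
      rw [pow_succ', ← mul_assoc, h, (hV.pow_left k).eq]
      simp only [mul_assoc]
    calc (T ^ (k + 1)) z = T ((T ^ k) z) := by rw [pow_succ']; rfl
      _ = (T * (S * (T ^ k * V))) y := by rw [hz]; rfl
      _ = S ((T ^ (k + 1)) y) := by rw [← h1]; rfl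

theorem Reduces.powRange_of_twist [CompleteSpace H] {S T V V' : H →L[ℂ] H}
    (h : S * T = T * (S * V)) (hV : Commute T V)
    (h' : adjoint S * T = T * (adjoint S * V')) (hV' : Commute T V') (k : ℕ) :
    Reduces (powRange T k) S :=
  ⟨fun _ hx => map_mem_powRange_of_twist h hV k hx,
    fun _ hx => map_mem_powRange_of_twist h' hV' k hx⟩

end Twisted

/-! ### Ordered products of powers along a list. -/

section OrderedProducts

variable {H : Type*} [NormedAddCommGroup H] [InnerProductSpace ℂ H] {n : ℕ}
  {T : Fin n → H →L[ℂ] H}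

/-- The ordered product of the powers `T i ^ g i` along a list of indices. -/
noncomputable def listPow (T : Fin n → H →L[ℂ] H) (g : Fin n → ℕ) (l : List (Fin n)) :
    H →L[ℂ] H :=
  (l.map fun i => T i ^ g i).prod

theorem listPow_cons (T : Fin n → H →L[ℂ] H) (g : Fin n → ℕ) (i : Fin n) (l : List (Fin n)) :
    listPow T g (i :: l) = T i ^ g i * listPow T g l := by
  simp [listPow]

theorem listPow_cons_apply (T : Fin n → H →L[ℂ] H) (g : Fin n → ℕ) (i : Fin n)
    (l : List (Fin n)) (x : H) :
    listPow T g (i :: l) x = (T i ^ g i) (listPow T g l x) := by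
  rw [listPow_cons]
  rfl

theorem listPow_nil (T : Fin n → H →L[ℂ] H) (g : Fin n → ℕ) : listPow T g [] = 1 := rfl

theorem listPow_congr {g g' : Fin n → ℕ} {l : List (Fin n)} (h : ∀ i ∈ l, g i = g' i) :
    listPow T g l = listPow T g' l := by
  unfold listPow
  congr 1
  exact List.map_congr_left fun i hi => by rw [h i hi]

/-- Extension of a multi-index by zero. -/
def extendMultiIndex (A : Finset (Fin n)) (k : A → ℕ) (i : Fin n) : ℕ :=
  if h : i ∈ A then k ⟨i, h⟩ else 0

theorem extendMultiIndex_of_mem {A : Finset (Fin n)} (k : A → ℕ) (i : A) :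
    extendMultiIndex A k i = k i := by
  simp [extendMultiIndex]

theorem extendMultiIndex_of_notMem {A : Finset (Fin n)} (k : A → ℕ) {i : Fin n} (h : i ∉ A) :
    extendMultiIndex A k i = 0 := by
  simp [extendMultiIndex, h]

theorem extendMultiIndex_restrict {A : Finset (Fin n)} {g : Fin n → ℕ}
    (hg : ∀ i, i ∉ A → g i = 0) : extendMultiIndex A (fun i => g i) = g := by
  ext i
  by_cases h : i ∈ A
  · simp [extendMultiIndex, h]
  · simp [extendMultiIndex, h, hg i h]

theorem tuplePow_eq_listPow (T : Fin n → H →L[ℂ] H) (A : Finset (Fin n)) (k : A → ℕ) :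
    tuplePow T A k = listPow T (extendMultiIndex A k) (List.finRange n) := by
  unfold tuplePow listPow
  rw [List.ofFn_eq_map]
  congr 1
  refine List.map_congr_left fun i _ => ?_
  by_cases h : i ∈ A <;> simp [extendMultiIndex, h]

theorem imageUnder_one (W : Submodule ℂ H) : imageUnder (1 : H →L[ℂ] H) W = W :=
  Submodule.map_id W

theorem imageUnder_mul (S S' : H →L[ℂ] H) (W : Submodule ℂ H) :
    imageUnder (S * S') W = imageUnder S (imageUnder S' W) :=
  Submodule.map_comp (S' : H →ₗ[ℂ] H) (S : H →ₗ[ℂ] H) W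

theorem imageUnder_mono (S : H →L[ℂ] H) {W W' : Submodule ℂ H} (h : W ≤ W') :
    imageUnder S W ≤ imageUnder S W' :=
  Submodule.map_mono h

theorem pow_apply_mem {N : Submodule ℂ H} {S : H →L[ℂ] H} (h : ∀ x ∈ N, S x ∈ N) (k : ℕ)
    {x : H} (hx : x ∈ N) : (S ^ k) x ∈ N := by
  induction k with
  | zero => exact hx
  | succ k ih => rw [pow_succ']; exact h _ ih

theorem listPow_apply_mem {N : Submodule ℂ H} {g : Fin n → ℕ} {l : List (Fin n)}
    (h : ∀ i ∈ l, g i ≠ 0 → ∀ x ∈ N, T i x ∈ N) {x : H} (hx : x ∈ N) : listPow T g l x ∈ N := by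
  induction l with
  | nil => exact hx
  | cons i l ih =>
    rw [listPow_cons_apply]
    have hl := ih fun j hj => h j (List.mem_cons_of_mem _ hj)
    by_cases hi : g i = 0
    · rw [hi, pow_zero]; exact hl
    · exact pow_apply_mem (h i List.mem_cons_self hi) _ hl

theorem imageUnder_pow_eq {N : Submodule ℂ H} {S : H →L[ℂ] H} (h : imageUnder S N = N) (k : ℕ) :
    imageUnder (S ^ k) N = N := by
  induction k with
  | zero => exact imageUnder_one N
  | succ k ih => rw [imageUnder_pow_succ, ih, h]

theorem imageUnder_listPow_eq {N : Submodule ℂ H} {g : Fin n → ℕ} {l : List (Fin n)}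
    (h : ∀ i ∈ l, g i ≠ 0 → imageUnder (T i) N = N) : imageUnder (listPow T g l) N = N := by
  induction l with
  | nil => exact imageUnder_one N
  | cons i l ih =>
    rw [listPow_cons, imageUnder_mul, ih fun j hj => h j (List.mem_cons_of_mem _ hj)]
    by_cases hi : g i = 0
    · rw [hi, pow_zero, imageUnder_one]
    · exact imageUnder_pow_eq (h i List.mem_cons_self hi) _

theorem listPow_single {i : Fin n} {g : Fin n → ℕ} (hg : ∀ j, j ≠ i → g j = 0)
    {l : List (Fin n)} (hl : l.Nodup) (hi : i ∈ l) : listPow T g l = T i ^ g i := by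
  have hone : ∀ l : List (Fin n), i ∉ l → listPow T g l = 1 := by
    intro l hl
    refine List.prod_eq_one fun S hS => ?_
    obtain ⟨j, hj, rfl⟩ := List.mem_map.1 hS
    rw [hg j (fun h => hl (h ▸ hj)), pow_zero]
  induction l with
  | nil => simp at hi
  | cons j l ih =>
    rw [List.nodup_cons] at hl
    rw [listPow_cons]
    by_cases hji : j = i
    · subst hji
      rw [hone l hl.1, mul_one]
    · rw [hg j hji, pow_zero, one_mul]
      exact ih hl.2 ((List.mem_cons.1 hi).resolve_left fun h => hji h.symm)

theorem IsNearIsometry.isClosed_imageUnder_listPow [CompleteSpace H]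
    (hT : ∀ i, IsNearIsometry (T i)) {W : Submodule ℂ H} (hW : IsClosed (W : Set H))
    (g : Fin n → ℕ) (l : List (Fin n)) : IsClosed (imageUnder (listPow T g l) W : Set H) := by
  induction l with
  | nil =>
    rw [listPow_nil, imageUnder_one]
    exact hW
  | cons i l ih =>
    rw [listPow_cons, imageUnder_mul]
    exact (hT i).isClosed_imageUnder_pow ih _

end OrderedProducts

/-! ### The candidate summands. -/

section WoldSpace

variable {H : Type*} [NormedAddCommGroup H] [InnerProductSpace ℂ H] {n : ℕ}
  {T : Fin n → H →L[ℂ] H}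

/-- The invertible part of `S`, or its orthogonal complement, the shift part. -/
noncomputable def woldPart (S : H →L[ℂ] H) (p : Prop) [Decidable p] : Submodule ℂ H :=
  if p then (powCore S)ᗮ else powCore S

/-- The joint part of the space on which `T i` is a shift for `i ∈ A` and invertible for
`i ∉ A`. -/
noncomputable def woldSpace (T : Fin n → H →L[ℂ] H) (A : Finset (Fin n)) : Submodule ℂ H :=
  ⨅ i, woldPart (T i) (i ∈ A)

theorem woldSpace_le_orthogonal_powCore {A : Finset (Fin n)} {i : Fin n} (h : i ∈ A) :
    woldSpace T A ≤ (powCore (T i))ᗮ :=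
  (iInf_le _ i).trans_eq (if_pos h)

theorem woldSpace_le_powCore {A : Finset (Fin n)} {i : Fin n} (h : i ∉ A) :
    woldSpace T A ≤ powCore (T i) :=
  (iInf_le _ i).trans_eq (if_neg h)

theorem le_woldSpace {A : Finset (Fin n)} {N : Submodule ℂ H}
    (h₁ : ∀ i ∈ A, N ≤ (powCore (T i))ᗮ) (h₂ : ∀ i, i ∉ A → N ≤ powCore (T i)) :
    N ≤ woldSpace T A := by
  refine le_iInf fun i => ?_
  unfold woldPart
  split_ifs with h
  · exact h₁ i h
  · exact h₂ i h

theorem woldSpace_isOrtho {A B : Finset (Fin n)} (h : A ≠ B) : woldSpace T A ⟂ woldSpace T B := by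
  have key : ∀ {A B : Finset (Fin n)} {i : Fin n}, i ∈ A → i ∉ B →
      woldSpace T A ⟂ woldSpace T B := fun hA hB =>
    (Submodule.isOrtho_orthogonal_left _).mono (woldSpace_le_orthogonal_powCore hA)
      (woldSpace_le_powCore hB)
  by_contra hc
  refine h (Finset.ext fun i => ⟨fun hA => ?_, fun hB => ?_⟩)
  · by_contra hB
    exact hc (key hA hB)
  · by_contra hA
    exact hc (key hB hA).symm

end WoldSpace

/-! ### Doubly twisted tuples: existence, uniqueness and the formula. -/

section Tuple

variable {H : Type*} [NormedAddCommGroup H] [InnerProductSpace ℂ H] [CompleteSpace H] {n : ℕ}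
  {T : Fin n → H →L[ℂ] H} {U : Fin n → Fin n → H →L[ℂ] H}

/-- With `T j` in the role of `S`, the twist `V` is `U*` for `i < j` and `U` for `j < i`; for the
adjoint `(T j)*` the two are exchanged. When `i < j` the relation for `(T j)*` is the adjoint of the
given one. -/
theorem IsDoublyTwistedNearIsometry.powRange_reduces (hT : IsDoublyTwistedNearIsometry T U)
    {i j : Fin n} (hij : i ≠ j) (k : ℕ) : Reduces (powRange (T i) k) (T j) := by
  have hU : ∀ i j, i < j → star (U i j) * U i j = 1 ∧ U i j * star (U i j) = 1 := fun i j h =>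
    Unitary.mem_iff.1 (hT.unitary i j h)
  have hc : ∀ i j k, i < j → Commute (T k) (U i j) := fun i j k h => hT.mul_twist i j k h
  have hcs : ∀ i j k, i < j → Commute (T k) (star (U i j)) := by
    intro i j k h
    have h1 := (hc i j k h).eq
    calc T k * star (U i j) = star (U i j) * (U i j * T k) * star (U i j) := by
          rw [← mul_assoc, (hU i j h).1, one_mul]
      _ = star (U i j) * T k := by
          rw [← h1, mul_assoc, mul_assoc, (hU i j h).2, mul_one]
  rcases hij.lt_or_gt with h | h
  · refine Reduces.powRange_of_twist (V := star (U i j)) (V' := U i j) ?_ (hcs i j i h) ?_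
      (hc i j i h) k
    · calc T j * T i = star (U i j) * (U i j * T j * T i) := by
            simp only [← mul_assoc, (hU i j h).1, one_mul]
        _ = T i * star (U i j) * T j := by
            rw [← hT.mul_mul i j h, ← mul_assoc, (hcs i j i h).eq]
        _ = T i * (T j * star (U i j)) := by rw [mul_assoc, (hcs i j j h).eq]
    · have h2 := congrArg star (hT.adjoint_mul i j h)
      simp only [← star_eq_adjoint, star_mul, star_star] at h2 ⊢
      rw [h2]
  · refine Reduces.powRange_of_twist (V := U j i) (V' := star (U j i)) ?_ (hc j i i h) ?_
      (hcs j i i h) k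
    · rw [hT.mul_mul j i h, ← (hc j i i h).eq, mul_assoc, (hc j i j h).eq]
    · rw [hT.adjoint_mul j i h, ← star_eq_adjoint, ← (hcs j i i h).eq, mul_assoc,
        ← star_eq_adjoint, ← star_mul, ← star_mul, (hc j i j h).eq]

theorem IsDoublyTwistedNearIsometry.powCore_reduces (hT : IsDoublyTwistedNearIsometry T U)
    (i j : Fin n) : Reduces (powCore (T i)) (T j) := by
  by_cases hij : i = j
  · subst hij
    exact (hT.nearIsometry i).powCore_reduces
  · exact Reduces.iInf fun k => hT.powRange_reduces hij k

theorem IsDoublyTwistedNearIsometry.powLayer_reduces (hT : IsDoublyTwistedNearIsometry T U)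
    {i j : Fin n} (hij : i ≠ j) (k : ℕ) : Reduces (powLayer (T i) k) (T j) :=
  (hT.powRange_reduces hij k).inf (hT.powRange_reduces hij (k + 1)).orthogonal

theorem IsNearIsometry.isClosed_powLayer {S : H →L[ℂ] H} (hS : IsNearIsometry S) (k : ℕ) :
    IsClosed (powLayer S k : Set H) :=
  Submodule.isClosed_inf_coe (hS.isClosed_powRange k) (Submodule.isClosed_orthogonal _)

/-- Factors to the right of index `a` preserve `ker (T a)*`, the factor at `a` lifts it to layer `g
a`, and those to the left preserve that layer. Thus exponents differing at `a` give orthogonal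
images. -/
theorem IsDoublyTwistedNearIsometry.listPow_mem_powLayer (hT : IsDoublyTwistedNearIsometry T U)
    {a : Fin n} {g : Fin n → ℕ} {l : List (Fin n)} (hl : l.Nodup) (ha : a ∈ l) {x : H}
    (hx : x ∈ powLayer (T a) 0) : listPow T g l x ∈ powLayer (T a) (g a) := by
  induction l with
  | nil => simp at ha
  | cons b l ih =>
    rw [List.nodup_cons] at hl
    rw [listPow_cons_apply]
    by_cases hab : a = b
    · subst hab
      refine (hT.nearIsometry a).pow_mem_powLayer (listPow_apply_mem (fun j hj _ => ?_) hx) _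
      exact (hT.powLayer_reduces (ne_of_mem_of_not_mem hj hl.1).symm 0).map_mem
    · exact pow_apply_mem (hT.powLayer_reduces hab _).map_mem _
        (ih hl.2 ((List.mem_cons.1 ha).resolve_left hab))

/-- A closed subspace that reduces the operators in a list, and lies in the shift parts of those
with index in `A`, is the closed span of the images of its wandering vectors. -/
theorem IsDoublyTwistedNearIsometry.le_of_listPow_mem (hT : IsDoublyTwistedNearIsometry T U)
    {A : Finset (Fin n)} {l : List (Fin n)} (hl : l.Nodup) {N Z : Submodule ℂ H}
    (hN : IsClosed (N : Set H)) (hZ : IsClosed (Z : Set H)) (hred : ∀ i ∈ l, Reduces N (T i))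
    (hE : ∀ i ∈ l, i ∈ A → N ≤ (powCore (T i))ᗮ)
    (h : ∀ g : Fin n → ℕ, (∀ i, i ∉ A → g i = 0) → ∀ x ∈ N,
      (∀ i ∈ l, i ∈ A → x ∈ powLayer (T i) 0) → listPow T g l x ∈ Z) : N ≤ Z := by
  induction l generalizing N Z with
  | nil => exact fun x hx => h 0 (fun _ _ => rfl) x hx (by simp)
  | cons i l ih =>
    rw [List.nodup_cons] at hl
    have hred' := fun j hj => hred j (List.mem_cons_of_mem _ hj)
    have hE' := fun j hj => hE j (List.mem_cons_of_mem _ hj)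
    have hTi := hT.nearIsometry i
    have hri := hred i List.mem_cons_self
    by_cases hi : i ∈ A
    · refine hri.le_of_inf_powLayer_le hTi.isClosed_powRange hN
        (hE i List.mem_cons_self hi) hZ fun k => ?_
      -- Layer `k` of `T i` inside `N` is the image of `N ∩ ker (T i)*`. This smaller space meets
      -- the hypotheses for the remaining list, with target `Z` pulled back along `T i ^ k`.
      have key : N ⊓ powLayer (T i) 0 ≤ Z.comap ((T i ^ k : H →L[ℂ] H) : H →ₗ[ℂ] H) := by
        refine ih hl.2 (Submodule.isClosed_inf_coe hN (hTi.isClosed_powLayer 0))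
          (Submodule.isClosed_comap_coe hZ _)
          (fun j hj => (hred' j hj).inf (hT.powLayer_reduces (ne_of_mem_of_not_mem hj hl.1).symm 0))
          (fun j hj hjA => inf_le_left.trans (hE' j hj hjA)) fun g hg x hx hxl => ?_
        have h1 := h (Function.update g i k) (fun j hj => ?_) x hx.1 (fun j hj hjA => ?_)
        · rw [listPow_cons_apply, Function.update_self,
            listPow_congr (g' := g) fun j hj => Function.update_of_ne
              (ne_of_mem_of_not_mem hj hl.1) _ _] at h1
          exact h1
        · rw [Function.update_of_ne (ne_of_mem_of_not_mem hi hj).symm]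
          exact hg j hj
        · rcases List.mem_cons.1 hj with rfl | hj
          · exact hx.2
          · exact hxl j hj hjA
      rintro x ⟨hxN, hxL⟩
      rw [hTi.powLayer_eq] at hxL
      obtain ⟨w, hw, rfl⟩ := hxL
      exact key ⟨(hri.pow k).mem_of_map_mem hN (hTi.pow_injective k) hxN, hw⟩
    · refine ih hl.2 hN hZ hred' hE' fun g hg x hx hxl => ?_
      have h1 := h g hg x hx fun j hj hjA => by
        rcases List.mem_cons.1 hj with rfl | hj
        · exact absurd hjA hi
        · exact hxl j hj hjA
      rwa [listPow_cons_apply, hg i hi, pow_zero] at h1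

theorem Reduces.woldPart {S R : H →L[ℂ] H} (h : Reduces (powCore S) R) (p : Prop) [Decidable p] :
    Reduces (woldPart S p) R := by
  unfold _root_.woldPart
  split_ifs
  · exact h.orthogonal
  · exact h

theorem IsNearIsometry.isClosed_woldPart {S : H →L[ℂ] H} (hS : IsNearIsometry S) (p : Prop)
    [Decidable p] : IsClosed (woldPart S p : Set H) := by
  unfold woldPart
  split_ifs
  · exact Submodule.isClosed_orthogonal _
  · exact hS.isClosed_powCore

theorem IsDoublyTwistedNearIsometry.isClosed_woldSpace (hT : IsDoublyTwistedNearIsometry T U)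
    (A : Finset (Fin n)) : IsClosed (woldSpace T A : Set H) :=
  Submodule.isClosed_iInf_coe fun i => (hT.nearIsometry i).isClosed_woldPart _

theorem IsDoublyTwistedNearIsometry.woldSpace_reduces (hT : IsDoublyTwistedNearIsometry T U)
    (A : Finset (Fin n)) (j : Fin n) : Reduces (woldSpace T A) (T j) :=
  Reduces.iInf fun i => (hT.powCore_reduces i j).woldPart _

/-- Indices are imposed one at a time: the projection onto the core of `T i` preserves the parts
already chosen for the other indices. Finitely many splittings suffice, so no closure is needed. -/
theorem IsDoublyTwistedNearIsometry.iSup_woldSpace (hT : IsDoublyTwistedNearIsometry T U) :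
    ⨆ A, woldSpace T A = ⊤ := by
  have key : ∀ S : Finset (Fin n),
      ⨆ A : Finset (Fin n), ⨅ i ∈ S, woldPart (T i) (i ∈ A) = ⊤ := by
    intro S
    induction S using Finset.induction_on with
    | empty => simp
    | insert i S hi ih =>
      rw [eq_top_iff, ← ih]
      refine iSup_le fun A x hx => ?_
      have : CompleteSpace (powCore (T i)) :=
        (hT.nearIsometry i).isClosed_powCore.completeSpace_coe
      have hP : ∀ j ∈ S, (powCore (T i)).starProjection x ∈ woldPart (T j) (j ∈ A) := by
        intro j hj
        refine ((powCore_reduces_starProjection (hT.powCore_reduces i j)).woldPart _).map_mem x ?_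
        exact (Submodule.mem_iInf _).1 ((Submodule.mem_iInf _).1 hx j) hj
      have hQ : ∀ j ∈ S, x - (powCore (T i)).starProjection x ∈ woldPart (T j) (j ∈ A) :=
        fun j hj => Submodule.sub_mem _
          ((Submodule.mem_iInf _).1 ((Submodule.mem_iInf _).1 hx j) hj) (hP j hj)
      -- The core component goes to `A` without `i`, the other to `A` with `i`; membership of the
      -- indices in `S` is unchanged because `i ∉ S`.
      rw [← add_sub_cancel ((powCore (T i)).starProjection x) x]
      refine Submodule.add_mem _ (Submodule.mem_iSup_of_mem (A.erase i) ?_)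
        (Submodule.mem_iSup_of_mem (insert i A) ?_)
      · simp only [Submodule.mem_iInf, Finset.mem_insert]
        rintro j (rfl | hj)
        · simp [woldPart]
        · have hji : j ≠ i := fun e => hi (e ▸ hj)
          simpa [woldPart, hji] using hP j hj
      · simp only [Submodule.mem_iInf, Finset.mem_insert]
        rintro j (rfl | hj)
        · simp [woldPart]
        · have hji : j ≠ i := fun e => hi (e ▸ hj)
          simpa [woldPart, hji] using hQ j hj
  simpa [woldSpace] using key Finset.univ

theorem IsDoublyTwistedNearIsometry.isWoldDecomposition (hT : IsDoublyTwistedNearIsometry T U) :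
    IsWoldDecomposition T (woldSpace T) where
  orthogonalSum :=
    { isClosed := hT.isClosed_woldSpace
      orthogonal := fun _ _ h => woldSpace_isOrtho h
      closure_iSup := by
        rw [hT.iSup_woldSpace, eq_top_iff]
        exact Submodule.le_topologicalClosure _ }
  reduces := hT.woldSpace_reduces
  shift A i h := (hT.woldSpace_reduces A i).isShift_restriction (hT.nearIsometry i)
    (hT.isClosed_woldSpace A) (woldSpace_le_orthogonal_powCore h)
  invertible A i h := (hT.woldSpace_reduces A i).isUnit_restriction (hT.nearIsometry i)
    (hT.isClosed_woldSpace A) (woldSpace_le_powCore h)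

/-- Once `𝓗 A ≤ woldSpace T A` for all `A`, a vector of `woldSpace T A` orthogonal to `𝓗 A` is
orthogonal to every `𝓗 B`, hence zero. -/
theorem IsWoldDecomposition.eq_woldSpace {𝓗 : Finset (Fin n) → Submodule ℂ H}
    (h : IsWoldDecomposition T 𝓗) : 𝓗 = woldSpace T := by
  have hle : ∀ A, 𝓗 A ≤ woldSpace T A := fun A => le_woldSpace
    (fun i hi => (h.reduces A i).le_orthogonal_powCore_of_isShift (h.orthogonalSum.isClosed A)
      (h.shift A i hi))
    (fun i hi => (h.reduces A i).le_powCore_of_isUnit (h.invertible A i hi))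
  funext A
  refine le_antisymm (hle A) fun x hx => ?_
  have : CompleteSpace (𝓗 A) := (h.orthogonalSum.isClosed A).completeSpace_coe
  have hy : x - (𝓗 A).starProjection x ∈ woldSpace T A :=
    Submodule.sub_mem _ hx (hle A (Submodule.starProjection_apply_mem _ x))
  have htop : (⊤ : Submodule ℂ H) ≤ (ℂ ∙ (x - (𝓗 A).starProjection x))ᗮ := by
    rw [← h.orthogonalSum.closure_iSup]
    refine Submodule.topologicalClosure_minimal _ (iSup_le fun B z hz => ?_)
      (Submodule.isClosed_orthogonal _)
    rw [Submodule.mem_orthogonal_singleton_iff_inner_right]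
    by_cases hAB : A = B
    · subst hAB
      exact Submodule.inner_left_of_mem_orthogonal hz
        (Submodule.sub_starProjection_mem_orthogonal x)
    · exact (woldSpace_isOrtho hAB).inner_eq hy (hle B hz)
  have h0 : x - (𝓗 A).starProjection x = 0 := inner_self_eq_zero.1
    (Submodule.mem_orthogonal_singleton_iff_inner_right.1 (htop Submodule.mem_top))
  rw [sub_eq_zero.1 h0]
  exact Submodule.starProjection_apply_mem _ x

theorem mem_wanderingSpace {A : Finset (Fin n)} {x : H} :
    x ∈ wanderingSpace T A ↔ ∀ i ∈ A, x ∈ powLayer (T i) 0 := by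
  simp only [wanderingSpace, Submodule.mem_iInf, powLayer_zero]

theorem IsDoublyTwistedNearIsometry.wanderingSpace_reduces (hT : IsDoublyTwistedNearIsometry T U)
    {A : Finset (Fin n)} {j : Fin n} (hj : j ∉ A) : Reduces (wanderingSpace T A) (T j) := by
  refine Reduces.iInf fun i => Reduces.iInf fun hi => ?_
  rw [← powLayer_zero]
  exact hT.powLayer_reduces (ne_of_mem_of_not_mem hi hj) 0

theorem IsDoublyTwistedNearIsometry.isClosed_wanderingSpace
    (hT : IsDoublyTwistedNearIsometry T U) (A : Finset (Fin n)) :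
    IsClosed (wanderingSpace T A : Set H) := by
  refine Submodule.isClosed_iInf_coe fun i => Submodule.isClosed_iInf_coe fun _ => ?_
  rw [← powLayer_zero]
  exact (hT.nearIsometry i).isClosed_powLayer 0

/-- The set `B` is kept separate from `Aᶜ` so that `A = ∅` can be used with `Finset.univ`. For `≥`,
each `T i` with `i ∉ A` maps the right-hand side onto itself, since that space reduces `T i` and
lies in its core. -/
theorem IsDoublyTwistedNearIsometry.iInf_imageUnder_tuplePow
    (hT : IsDoublyTwistedNearIsometry T U) {A B : Finset (Fin n)} (hB : B = Aᶜ) :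
    ⨅ l : B → ℕ, imageUnder (tuplePow T B l) (wanderingSpace T A) =
      woldSpace T A ⊓ wanderingSpace T A := by
  have hmem : ∀ i, i ∈ B ↔ i ∉ A := by simp [hB]
  refine le_antisymm (le_inf ?_ ?_) (le_iInf fun l => ?_)
  · refine le_woldSpace (fun i hi => ?_) fun i hi => ?_
    · refine le_trans ((iInf_le _ 0).trans ?_) (powLayer_le_orthogonal_powCore (T i) 0)
      rw [tuplePow_eq_listPow]
      rintro _ ⟨x, hx, rfl⟩
      refine listPow_apply_mem (fun j _ hj => ?_) (mem_wanderingSpace.1 hx i hi)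
      by_cases hjB : j ∈ B
      · exact absurd (extendMultiIndex_of_mem 0 ⟨j, hjB⟩) hj
      · exact absurd (extendMultiIndex_of_notMem 0 hjB) hj
    · refine le_iInf fun k => ?_
      -- The multi-index concentrated at `i` with value `k` puts the intersection inside the range
      -- of `T i ^ k`.
      refine (iInf_le _ fun j : B => if (j : Fin n) = i then k else 0).trans ?_
      rw [tuplePow_eq_listPow, listPow_single (i := i) (fun j hj => ?_) (List.nodup_finRange n)
        (List.mem_finRange i)]
      · have : extendMultiIndex B (fun j : B => if (j : Fin n) = i then k else 0) i = k := by
          simp [extendMultiIndex, hmem, hi]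
        rw [this]
        exact imageUnder_mono _ le_top
      · simp [extendMultiIndex, hj]
  · refine (iInf_le _ 0).trans ?_
    rw [tuplePow_eq_listPow, imageUnder_listPow_eq fun i _ hi => ?_]
    by_cases hiB : i ∈ B
    · exact absurd (extendMultiIndex_of_mem 0 ⟨i, hiB⟩) hi
    · exact absurd (extendMultiIndex_of_notMem 0 hiB) hi
  · have hfix : imageUnder (tuplePow T B l) (woldSpace T A ⊓ wanderingSpace T A) =
        woldSpace T A ⊓ wanderingSpace T A := by
      rw [tuplePow_eq_listPow]
      refine imageUnder_listPow_eq fun i _ hi => ?_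
      have hiA : i ∉ A := (hmem i).1 (by
        by_contra hiB
        exact hi (extendMultiIndex_of_notMem l hiB))
      exact ((hT.woldSpace_reduces A i).inf (hT.wanderingSpace_reduces hiA)).imageUnder_eq
        (hT.nearIsometry i)
        (Submodule.isClosed_inf_coe (hT.isClosed_woldSpace A) (hT.isClosed_wanderingSpace A))
        (inf_le_left.trans (woldSpace_le_powCore hiA))
    rw [← hfix]
    exact imageUnder_mono _ inf_le_right

theorem IsDoublyTwistedNearIsometry.wanderingCore_eq (hT : IsDoublyTwistedNearIsometry T U)
    (A : Finset (Fin n)) : wanderingCore T A = woldSpace T A ⊓ wanderingSpace T A :=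
  hT.iInf_imageUnder_tuplePow rfl

theorem IsDoublyTwistedNearIsometry.woldSpace_empty (hT : IsDoublyTwistedNearIsometry T U) :
    woldSpace T ∅ = ⨅ k : ↥(Finset.univ : Finset (Fin n)) → ℕ,
      imageUnder (tuplePow T Finset.univ k) ⊤ := by
  have h := hT.iInf_imageUnder_tuplePow (A := ∅) (B := Finset.univ) Finset.compl_empty.symm
  have htop : wanderingSpace T ∅ = ⊤ := by simp [wanderingSpace]
  rw [htop, inf_top_eq] at h
  exact h.symm

theorem IsDoublyTwistedNearIsometry.isOrthogonalSum_woldSpace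
    (hT : IsDoublyTwistedNearIsometry T U) (A : Finset (Fin n)) :
    IsOrthogonalSum (woldSpace T A)
      (fun k : A → ℕ => imageUnder (tuplePow T A k) (wanderingCore T A)) := by
  have hcore : IsClosed (wanderingCore T A : Set H) := by
    rw [hT.wanderingCore_eq]
    exact Submodule.isClosed_inf_coe (hT.isClosed_woldSpace A) (hT.isClosed_wanderingSpace A)
  refine ⟨fun k => ?_, fun k k' hkk => ?_, le_antisymm ?_ ?_⟩
  · rw [tuplePow_eq_listPow]
    exact IsNearIsometry.isClosed_imageUnder_listPow hT.nearIsometry hcore _ _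
  -- At an index `a` where the multi-indices differ, the two images lie in different layers of `T
  -- a`.
  · obtain ⟨a, ha⟩ := Function.ne_iff.1 hkk
    have hsub : ∀ k : A → ℕ,
        imageUnder (tuplePow T A k) (wanderingCore T A) ≤ powLayer (T a) (k a) := by
      rintro k _ ⟨x, hx, rfl⟩
      rw [hT.wanderingCore_eq] at hx
      rw [tuplePow_eq_listPow, ← extendMultiIndex_of_mem k a]
      exact hT.listPow_mem_powLayer (List.nodup_finRange n) (List.mem_finRange _)
        (mem_wanderingSpace.1 hx.2 a a.2)
    exact (powLayer_isOrtho (T a) ha).mono (hsub k) (hsub k')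
  · refine Submodule.topologicalClosure_minimal _ (iSup_le fun k => ?_) (hT.isClosed_woldSpace A)
    rintro _ ⟨x, hx, rfl⟩
    rw [hT.wanderingCore_eq] at hx
    rw [tuplePow_eq_listPow]
    exact listPow_apply_mem (fun i _ _ => (hT.woldSpace_reduces A i).map_mem) hx.1
  · refine hT.le_of_listPow_mem (A := A) (List.nodup_finRange n) (hT.isClosed_woldSpace A)
      (Submodule.isClosed_topologicalClosure _) (fun i _ => hT.woldSpace_reduces A i)
      (fun i _ hi => woldSpace_le_orthogonal_powCore hi) fun g hg x hx hxl => ?_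
    refine Submodule.le_topologicalClosure _ (Submodule.mem_iSup_of_mem (fun i => g i) ?_)
    rw [tuplePow_eq_listPow, extendMultiIndex_restrict hg]
    refine ⟨x, ?_, rfl⟩
    rw [hT.wanderingCore_eq]
    exact ⟨hx, mem_wanderingSpace.2 fun i hi => hxl i (List.mem_finRange i) hi⟩

end Tuple

theorem theorem1 {H : Type*} [NormedAddCommGroup H] [InnerProductSpace ℂ H] [CompleteSpace H]
    {n : ℕ} (hn : 2 ≤ n) (T : Fin n → H →L[ℂ] H) (U : Fin n → Fin n → H →L[ℂ] H)
    (hT : IsDoublyTwistedNearIsometry T U) :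
    (∃! 𝓗 : Finset (Fin n) → Submodule ℂ H, IsWoldDecomposition T 𝓗) ∧
    ∀ 𝓗 : Finset (Fin n) → Submodule ℂ H, IsWoldDecomposition T 𝓗 →
      (∀ A : Finset (Fin n),
        IsOrthogonalSum (𝓗 A) (fun k : A → ℕ => imageUnder (tuplePow T A k) (wanderingCore T A))) ∧
      𝓗 ∅ = ⨅ k : ↥(Finset.univ : Finset (Fin n)) → ℕ,
        imageUnder (tuplePow T Finset.univ k) ⊤ := by
  refine ⟨⟨woldSpace T, hT.isWoldDecomposition, fun 𝓗 h => h.eq_woldSpace⟩, fun 𝓗 h => ?_⟩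
  rw [h.eq_woldSpace]
  exact ⟨hT.isOrthogonalSum_woldSpace, hT.woldSpace_empty⟩
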